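/- Let $k$ be an algebraically closed field and let $S$ be an irreducible algebraic monoid over $k$, i.e. an irreducible algebraic variety over $k$ (a reduced, separated scheme of finite type, not assumed affine or normal) with an associative product $S\times S\to S$ that is a morphism of varieties and has a two-sided identity $1\in S$. Let $$G=G(S)=\{g\in S : \exists\, g'\in S,\ gg'=g'g=1\}$$ be its group of units (points are $k$-points). Then: 1. $G$ is open in $S$ and, as an open subvariety with the restricted product, it is a connected algebraic group (in particular $g\mapsto g^{-1}$ is a morphism $G\to G$). 2. $S$, with the action $(a,b)\cdot s=asb^{-1}$ of $G\times G$, is a simple embedding of $G$. That is: there is an $x\in S$ whose $(G\times G)$-orbit is open in $S$ and, as an open subvariety, is $(G\times G)$-equivariantly isomorphic to $G\cong(G\times G)/\Delta(G)$, where $G\times G$ acts on $G$ by $(a,b)\cdot g=agb^{-1}$; and there is exactly one closed $(G\times G)$-orbit in $S$. 3. The unique closed $(G\times G)$-orbit $Y$ is the kernel of $S$: it is an ideal (a non-empty subset $I\subset S$ with $SIS\subset I$) and it is contained in every ideal of $S$. 4. If $s,t\in S$ satisfy $st=1$, then $s$ and $t$ are both units; that is, an element of $S$ with a left or a right inverse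 is a unit. -/

import Mathlib

open CategoryTheory AlgebraicGeometry MonoidalCategory CartesianMonoidalCategory
open scoped MonObj

universe u

namespace AlgMonoid

section Varieties

variable {k : Type u} [Field k]

/-- A (not necessarily irreducible) algebraic variety over `k`: a reduced separated scheme of
finite type over `k`. -/
class IsVariety (X : Over (Spec (.of k))) : Prop where
  isReduced : IsReduced X.left
  isSeparated : IsSeparated X.hom
  locallyOfFiniteType : LocallyOfFiniteType X.hom
  quasiCompact : QuasiCompact X.hom

/-- The set `X(k)` of `k`-rational points. For a monoid (group) object it carries the monoid
(group) structure `Hom.monoid` (`Hom.group`) of Mathlib, and a module object over a monoid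
object `M` gives an action of `M(k)` on `X(k)`. -/
abbrev Points (X : Over (Spec (.of k))) : Type u := 𝟙_ (Over (Spec (.of k))) ⟶ X

/-- The point of the underlying topological space given by a `k`-rational point. -/
noncomputable def Points.pt {X : Over (Spec (.of k))} (p : Points X) : X.left :=
  p.left (IsLocalRing.closedPoint k)

/-- The Zariski topology on `X(k)`. -/
noncomputable instance Points.zariskiTopology (X : Over (Spec (.of k))) : TopologicalSpace (Points X) :=
  TopologicalSpace.induced Points.pt inferInstance

/-- The open subscheme `U` of `X`, as a scheme over `k`. -/
noncomputable abbrev openSub (X : Over (Spec (.of k))) (U : X.left.Opens) :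
    Over (Spec (.of k)) :=
  Over.mk (U.ι ≫ X.hom)

/-- The inclusion of the open subscheme `U` in `X`, as a morphism over `k`. -/
noncomputable abbrev openSubι (X : Over (Spec (.of k))) (U : X.left.Opens) : openSub X U ⟶ X :=
  Over.homMk U.ι

/-- The set of `k`-rational points of the open subscheme `U` of `X`. -/
def openPoints (X : Over (Spec (.of k))) (U : X.left.Opens) : Set (Points X) :=
  {p | p.pt ∈ U}

end Varieties

section TwoSided

variable {C : Type*} [Category* C] [CartesianMonoidalCategory C]
  {G S : C} [GrpObj G] [MonObj S]

/-- The morphism `(G × G) × S ⟶ S`, `((a, b), s) ↦ i(a) * s * i(b⁻¹)`. -/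
def twoSidedMap (i : G ⟶ S) : (G ⊗ G) ⊗ S ⟶ S :=
  (fst _ _ ≫ fst _ _ ≫ i) * snd _ _ * ((fst _ _ ≫ snd _ _)⁻¹ ≫ i)

lemma comp_twoSidedMap (i : G ⟶ S) {T : C} (f : T ⟶ (G ⊗ G) ⊗ S) :
    f ≫ twoSidedMap i = (f ≫ fst _ _ ≫ fst _ _ ≫ i) * (f ≫ snd _ _) *
      ((f ≫ fst _ _ ≫ snd _ _)⁻¹ ≫ i) := by
  simp [twoSidedMap, MonObj.comp_mul, ← GrpObj.comp_inv]

/-- The action `(a, b) • s = i(a) * s * i(b⁻¹)` of `G × G` on `S`, where `i : G ⟶ S` is a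
homomorphism from a group to a monoid. -/
@[reducible] def twoSidedAction [BraidedCategory C] (i : G ⟶ S) [IsMonHom i] :
    ModObj (G ⊗ G) S where
  smul := twoSidedMap i
  one_smul := by
    change η ▷ S ≫ twoSidedMap i = (λ_ S).hom
    rw [comp_twoSidedMap]
    have h1 : (η[G ⊗ G] ▷ S) ≫ fst _ _ ≫ fst _ _ = 1 := by
      rw [whiskerRight_fst_assoc, IsMonHom.one_hom, Hom.one_def, toUnit_unique (fst _ _)]
    have h2 : (η[G ⊗ G] ▷ S) ≫ fst _ _ ≫ snd _ _ = 1 := by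
      rw [whiskerRight_fst_assoc, IsMonHom.one_hom, Hom.one_def, toUnit_unique (fst _ _)]
    rw [h2, reassoc_of% h1]
    simp [MonObj.one_comp, leftUnitor_hom]
  mul_smul := by
    change μ ▷ S ≫ twoSidedMap i =
      (α_ _ _ _).hom ≫ (G ⊗ G) ◁ twoSidedMap i ≫ twoSidedMap i
    have h1 : (μ[G ⊗ G] ▷ S) ≫ fst _ _ ≫ fst _ _ =
        (fst _ _ ≫ fst _ _ ≫ fst _ _) * (fst _ _ ≫ snd _ _ ≫ fst _ _) := by
      rw [whiskerRight_fst_assoc, IsMonHom.mul_hom, MonObj.mul_eq_mul, MonObj.comp_mul,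
        MonObj.comp_mul]
      simp
    have h2 : (μ[G ⊗ G] ▷ S) ≫ fst _ _ ≫ snd _ _ =
        (fst _ _ ≫ fst _ _ ≫ snd _ _) * (fst _ _ ≫ snd _ _ ≫ snd _ _) := by
      rw [whiskerRight_fst_assoc, IsMonHom.mul_hom, MonObj.mul_eq_mul, MonObj.comp_mul,
        MonObj.comp_mul]
      simp
    rw [comp_twoSidedMap, h2, reassoc_of% h1, ← Category.assoc, comp_twoSidedMap]
    have key {A B : C} (f : A ⟶ B) (g : B ⟶ G) : f ≫ g⁻¹ ≫ i = (f ≫ g)⁻¹ ≫ i := by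
      rw [← Category.assoc, GrpObj.comp_inv]
    simp only [Category.assoc, whiskerRight_snd, whiskerLeft_fst_assoc, whiskerLeft_snd,
      comp_twoSidedMap, MonObj.comp_mul, mul_inv_rev, MonObj.mul_comp, key, mul_assoc,
      associator_hom_fst_assoc, associator_hom_snd_fst_assoc, associator_hom_snd_snd]

/-- On `T`-valued points the action is `(a, b) • s = i(a) * s * i(b⁻¹)`. -/
lemma twoSidedAction_smul [BraidedCategory C] (i : G ⟶ S) [IsMonHom i] {T : C} (a b : T ⟶ G)
    (s : T ⟶ S) :
    letI := twoSidedAction i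
    (lift a b : T ⟶ G ⊗ G) • s = (a ≫ i) * s * (b⁻¹ ≫ i) := by
  change lift (lift a b) s ≫ twoSidedMap i = _
  simp [comp_twoSidedMap]

end TwoSided

section Embeddings

variable {k : Type u} [Field k]

/-- `X`, a `(G × G)`-variety, is an embedding of `G`: some orbit is open in `X` and, as an open
subvariety, is `(G × G)`-equivariantly isomorphic to `G` with the action
`(a, b) • g = a * g * b⁻¹`. -/
def IsGroupEmbedding (G X : Over (Spec (.of k))) [GrpObj G] [ModObj (G ⊗ G) X] : Prop :=
  letI := twoSidedAction (𝟙 G)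
  ∃ (x : Points X) (U : X.left.Opens) (e : G ≅ openSub X U),
    MulAction.orbit (Points (G ⊗ G)) x = openPoints X U ∧
    IsModHom (G ⊗ G) (e.hom ≫ openSubι X U)

/-- `Y` is a closed orbit of the action of `M(k)` on `X(k)`. -/
def IsClosedOrbit (M X : Over (Spec (.of k))) [MonObj M] [ModObj M X]
    (Y : Set (Points X)) : Prop :=
  (∃ x, Y = MulAction.orbit (Points M) x) ∧ IsClosed Y

/-- An embedding of `G` with exactly one closed orbit. -/
def IsSimpleGroupEmbedding (G X : Over (Spec (.of k))) [GrpObj G] [ModObj (G ⊗ G) X] : Prop :=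
  IsGroupEmbedding G X ∧ ∃! Y, IsClosedOrbit (G ⊗ G) X Y

end Embeddings

section Monoids

variable {M : Type*} [Monoid M]

/-- The set of units of `M`. -/
def unitSet (M : Type*) [Monoid M] : Set M :=
  {g | ∃ g', g * g' = 1 ∧ g' * g = 1}

/-- A (nonempty, two-sided) ideal of a monoid. -/
def IsMonoidIdeal (I : Set M) : Prop :=
  I.Nonempty ∧ ∀ s t : M, ∀ x ∈ I, s * x * t ∈ I

/-- `Y` is the kernel of the monoid: an ideal contained in all ideals. -/
def IsMonoidKernel (Y : Set M) : Prop :=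
  IsMonoidIdeal Y ∧ ∀ I : Set M, IsMonoidIdeal I → Y ⊆ I

end Monoids

end AlgMonoid

/-!
The main point is that `S` contains a nonempty open subset consisting of units, with inversion a
morphism; everything else follows by translation and density.

The pairs `(x, y)` with `x * y = 1 = y * x` form a closed subscheme of `S × S`, whose first
projection to `S` is a monomorphism because inverses are unique (`unitObj`, `unitι`). It is
dominant: a point of `S` with values in an infinitesimal thickening `T = Spec A` of a `k`-point
that reduces to `1` is a unit, because left translation by it on the product of `T` with an affine
neighbourhood of `1` is the identity modulo a nilpotent ideal of `A`, hence an automorphism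
(`isUnit_of_comp_eq_one`). Neither smoothness nor dimension theory is needed. Applied to the
truncations of the local ring of `S` at `1`, and combined with Krull's intersection theorem, this
shows that the local ring of `S` at `1` injects into that of the scheme of units
(`exists_injective_stalkMap_unitι`). So the generic point of `S` is a unit; over it the
monomorphism is flat and surjective, hence an isomorphism, and its inverse spreads out to an open
subset (`exists_isUnit_openSubι`). The union `unitOpens S` of all open subsets whose inclusion is a
unit of the monoid of points of `S` is stable under translation by units, and represents the
functor of units on schemes locally of finite type, which makes it a group object
(`exists_grpObj_unitOpens`).

For the orbits one works with the Noetherian space `S(k)`. An orbit is constructible by Chevalley's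
theorem, so it is open in its closure, and an orbit in a minimal nonempty closed invariant subset
is closed (`exists_isClosed_unitOrbit`). Since the units are dense, a closed orbit is an ideal, and
then it lies in every ideal (`isMonoidKernel_of_isClosed_unitOrbit`); this also gives uniqueness.
If `s * t = 1`, the closed subsets `t ^ n * S(k)` decrease, and `t * s = 1` follows as soon as two
successive ones agree (`mul_eq_one_symm_of_noetherianSpace`).
-/

namespace AlgMonoid

open Limits TopologicalSpace

/-! ### Constructible sets -/

section ConstructibleSets

/-- A constructible set that meets an open set `V` contains a nonempty open piece of its closure,
which can be found inside `V`. -/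
lemma exists_isOpen_inter_closure_subset {X : Type*} [TopologicalSpace X]
    {E : Set X} (hE : Topology.IsConstructible E) {V : Set X} (hV : IsOpen V)
    (hVE : (V ∩ E).Nonempty) :
    ∃ O ⊆ V, IsOpen O ∧ (O ∩ E).Nonempty ∧ O ∩ closure E ⊆ E := by
  induction E, hE using BooleanSubalgebra.closure_sdiff_sup_induction generalizing V with
  | isSublattice =>
    exact ⟨fun s hs t ht ↦ ⟨hs.1.union ht.1, hs.2.union ht.2⟩,
      fun s hs t ht ↦ ⟨hs.1.inter ht.1, hs.2.inter_isOpen ht.2 ht.1⟩⟩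
  | bot_mem => exact ⟨isOpen_empty, .empty⟩
  | top_mem => exact ⟨isOpen_univ, .univ⟩
  | sdiff A hA B hB =>
    obtain ⟨x, hxV, hxA, hxB⟩ := hVE
    refine ⟨V ∩ A, Set.inter_subset_left, hV.inter hA.1, ⟨x, ⟨hxV, hxA⟩, hxA, hxB⟩, ?_⟩
    rintro y ⟨⟨-, hyA⟩, hy⟩
    refine ⟨hyA, ?_⟩
    exact closure_minimal (fun z hz ↦ hz.2) hB.1.isClosed_compl hy
  | sup s _ t _ hs ht =>
    -- If `s` meets `V` outside `closure t`, then `t` plays no role there; otherwise `s` does not.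
    by_cases h : (V ∩ (closure t)ᶜ ∩ s).Nonempty
    · obtain ⟨O, hOV, hO, ⟨x, hxO, hxs⟩, hOs⟩ := hs (hV.inter isClosed_closure.isOpen_compl) h
      refine ⟨O, hOV.trans Set.inter_subset_left, hO, ⟨x, hxO, Or.inl hxs⟩, ?_⟩
      rintro y ⟨hyO, hy⟩
      replace hy : y ∈ closure s ∪ closure t := closure_union.subset hy
      exact Or.inl (hOs ⟨hyO, hy.resolve_right (hOV hyO).2⟩)
    · have hst : V ∩ s ⊆ closure t := fun x hx ↦ by
        by_contra hxt
        exact h ⟨x, ⟨hx.1, hxt⟩, hx.2⟩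
      have hVt : (V ∩ t).Nonempty := by
        obtain ⟨x, hxV, hx | hx⟩ := hVE
        · exact mem_closure_iff.1 (hst ⟨hxV, hx⟩) V hV hxV
        · exact ⟨x, hxV, hx⟩
      obtain ⟨O, hOV, hO, ⟨x, hxO, hxt⟩, hOt⟩ := ht hV hVt
      refine ⟨O, hOV, hO, ⟨x, hxO, Or.inr hxt⟩, ?_⟩
      rintro y ⟨hyO, hy⟩
      replace hy : y ∈ closure s ∪ closure t := closure_union.subset hy
      refine Or.inr (hOt ⟨hyO, hy.elim (fun hy ↦ ?_) id⟩)
      refine closure_minimal hst isClosed_closure ?_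
      exact hV.inter_closure ⟨hOV hyO, hy⟩

end ConstructibleSets

/-! ### Rational points -/

section Points

variable {k : Type u} [Field k]

lemma Points.pt_comp {X Y : Over (Spec (.of k))} (p : Points X) (f : X ⟶ Y) :
    Points.pt (p ≫ f) = f.left p.pt := by
  rfl

lemma Points.continuous_pt (X : Over (Spec (.of k))) : Continuous (Points.pt (X := X)) :=
  continuous_induced_dom

lemma Points.isInducing_pt (X : Over (Spec (.of k))) :
    Topology.IsInducing (Points.pt (X := X)) := ⟨rfl⟩

lemma Points.continuous_comp {X Y : Over (Spec (.of k))} (f : X ⟶ Y) :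
    Continuous (fun p : Points X ↦ (p ≫ f : Points Y)) := by
  rw [(Points.isInducing_pt Y).continuous_iff]
  have : Points.pt ∘ (fun p : Points X ↦ (p ≫ f : Points Y)) = f.left ∘ Points.pt :=
    funext fun p ↦ p.pt_comp f
  rw [this]
  exact f.left.continuous.comp (Points.continuous_pt X)

instance Points.noetherianSpace (X : Over (Spec (.of k))) [NoetherianSpace X.left] :
    NoetherianSpace (Points X) :=
  (Points.isInducing_pt X).noetherianSpace

variable [IsAlgClosed k]

lemma Points.isClosed_pt {X : Over (Spec (.of k))} [LocallyOfFiniteType X.hom] (p : Points X) :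
    IsClosed {p.pt} :=
  (pointEquivClosedPoint X.hom ⟨p.left, by simp⟩).2

lemma Points.exists_pt_eq {X : Over (Spec (.of k))} [LocallyOfFiniteType X.hom] {x : X.left}
    (hx : IsClosed {x}) : ∃ p : Points X, p.pt = x :=
  ⟨Over.homMk (pointOfClosedPoint X.hom x hx) (by simp), pointOfClosedPoint_apply X.hom x hx _⟩

lemma Points.pt_injective {X : Over (Spec (.of k))} [LocallyOfFiniteType X.hom] :
    Function.Injective (Points.pt (X := X)) := fun p q h ↦ by
  ext1
  exact ext_of_apply_closedPoint_eq X.hom (by simp) (by simp) h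

lemma Points.exists_pt_mem {X : Over (Spec (.of k))} [LocallyOfFiniteType X.hom] {Z : Set X.left}
    (hZ : IsLocallyClosed Z) (hne : Z.Nonempty) : ∃ p : Points X, p.pt ∈ Z := by
  have : JacobsonSpace X.left := LocallyOfFiniteType.jacobsonSpace (Y := Spec _) X.hom
  obtain ⟨x, hxZ, hx⟩ := nonempty_inter_closedPoints hne hZ
  obtain ⟨p, rfl⟩ := Points.exists_pt_eq (X := X) hx
  exact ⟨p, hxZ⟩

/-- A `k`-point of `Y` in the image of `f : X ⟶ Y` lifts to a `k`-point of `X`. -/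
lemma Points.exists_comp_eq {X Y : Over (Spec (.of k))} [LocallyOfFiniteType X.hom]
    [LocallyOfFiniteType Y.hom] (f : X ⟶ Y) (p : Points Y) (hp : p.pt ∈ Set.range f.left) :
    ∃ q : Points X, q ≫ f = p := by
  obtain ⟨x, hx⟩ := hp
  obtain ⟨q, hq⟩ := Points.exists_pt_mem (X := X)
    (p.isClosed_pt.preimage f.left.continuous).isLocallyClosed ⟨x, hx⟩
  exact ⟨q, Points.pt_injective (by rw [Points.pt_comp]; exact hq)⟩

/-- Two morphisms to a separated scheme agree on a closed set of `k`-points: the image of the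
`k`-points of their equalizer. -/
lemma Points.isClosed_setOf_comp_eq {X Y : Over (Spec (.of k))} [LocallyOfFiniteType X.hom]
    [IsSeparated Y.hom] (f g : X ⟶ Y) : IsClosed {p : Points X | p ≫ f = p ≫ g} := by
  have h : {p : Points X | p ≫ f = p ≫ g} =
      Points.pt ⁻¹' (Set.range (equalizer.ι f g).left) := by
    ext p
    constructor
    · intro hp
      refine ⟨Points.pt (equalizer.lift p hp : Points (equalizer f g)), ?_⟩
      rw [← Points.pt_comp, equalizer.lift_ι]
    · intro hp
      have : LocallyOfFiniteType (equalizer f g).hom := by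
        rw [← Over.w (equalizer.ι f g)]; infer_instance
      obtain ⟨q, rfl⟩ := Points.exists_comp_eq (equalizer.ι f g) p hp
      change (q ≫ _) ≫ f = (q ≫ _) ≫ g
      rw [Category.assoc, Category.assoc, equalizer.condition]
  rw [h]
  exact (equalizer.ι f g).left.isClosedEmbedding.isClosed_range.preimage (Points.continuous_pt X)

end Points

/-! ### Endomorphisms of infinitesimal thickenings -/

section Thickening

/-- An endomorphism of an `A`-algebra `C` that is the identity modulo a nilpotent ideal `J` of `A`
is bijective: it differs from the identity by an `A`-linear map that raises the `J`-adic
filtration, hence is nilpotent. -/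
lemma bijective_of_sub_mem_map_of_isNilpotent {A C : Type*} [CommRing A] [CommRing C] [Algebra A C]
    {J : Ideal A} (hJ : IsNilpotent J) (θ : C →ₐ[A] C)
    (h : ∀ c, θ c - c ∈ J.map (algebraMap A C)) : Function.Bijective θ := by
  obtain ⟨n, hn⟩ := hJ
  let ν : Module.End A C := θ.toLinearMap - 1
  have key : ∀ i c, (ν ^ i) c ∈ (J ^ i • ⊤ : Submodule A C) := by
    intro i
    induction i with
    | zero => intro c; rw [pow_zero, Ideal.one_eq_top, Submodule.top_smul]; trivial
    | succ i ih =>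
      intro c
      rw [pow_succ' ν, Module.End.mul_apply]
      have hν : ∀ x, ν x ∈ (J • ⊤ : Submodule A C) := fun x ↦ by
        rw [Ideal.smul_top_eq_map]
        exact h x
      refine Submodule.smul_induction_on (ih c) (fun a ha x _ ↦ ?_) (fun x y hx hy ↦ ?_)
      · rw [map_smul, pow_succ, Submodule.mul_smul]
        exact Submodule.smul_mem_smul ha (hν x)
      · rw [map_add]
        exact add_mem hx hy
  have hν : IsNilpotent ν := ⟨n, by
    ext c
    simpa [hn] using key n c⟩
  have hu : IsUnit (1 + ν) := hν.isUnit_one_add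
  have h1 : (1 + ν : Module.End A C) = θ.toLinearMap := by simp [ν]
  rw [h1, Module.End.isUnit_iff] at hu
  exact hu

/-- Let `X` be an affine scheme over `Spec A`, and `φ : A ⟶ B` a surjection with nilpotent kernel.
An endomorphism of `X` over `Spec A` that restricts to the identity of `X ×_{Spec A} Spec B` is an
isomorphism. -/
lemma isIso_of_isPullback_of_isNilpotent {X Z : Scheme.{u}} [IsAffine X] {A B : CommRingCat.{u}}
    {π : X ⟶ Spec A} {φ : A ⟶ B} {j : Z ⟶ X} {π₀ : Z ⟶ Spec B}
    (hZ : IsPullback j π₀ π (Spec.map φ)) (hφ : Function.Surjective φ.hom)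
    (hJ : IsNilpotent (RingHom.ker φ.hom)) (Θ : X ⟶ X) (hπ : Θ ≫ π = π) (hj : j ≫ Θ = j) :
    IsIso Θ := by
  obtain ⟨C, ⟨e⟩⟩ : ∃ C : CommRingCat.{u}, Nonempty (X ≅ Spec C) := ⟨_, ⟨X.isoSpec⟩⟩
  obtain ⟨α, hα⟩ := Spec.map_surjective (e.inv ≫ π)
  obtain ⟨θ, hθ⟩ := Spec.map_surjective (e.inv ≫ Θ ≫ e.hom)
  have hαθ : α ≫ θ = α := Spec.map_injective (by simp [hα, hθ, hπ])
  algebraize [α.hom]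
  let J := RingHom.ker φ.hom
  let q : C ⟶ CommRingCat.of (C ⧸ J.map α.hom) := CommRingCat.ofHom (Ideal.Quotient.mk _)
  -- The closed subscheme of `Spec C` defined by `J` maps to `Z`, where `Θ` is the identity.
  have hker : ∀ a ∈ RingHom.ker φ.hom, (α ≫ q).hom a = 0 := fun a ha ↦
    Ideal.Quotient.eq_zero_iff_mem.2 (Ideal.mem_map_of_mem _ ha)
  let β : B ⟶ CommRingCat.of (C ⧸ J.map α.hom) :=
    CommRingCat.ofHom (φ.hom.liftOfSurjective hφ ⟨(α ≫ q).hom, hker⟩)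
  have hβ : φ ≫ β = α ≫ q := by
    ext a
    exact φ.hom.liftOfRightInverse_comp_apply _ (Function.rightInverse_surjInv hφ)
      ⟨(α ≫ q).hom, hker⟩ a
  let l := hZ.lift (Spec.map q ≫ e.inv) (Spec.map β) (by
    rw [Category.assoc, ← hα, ← Spec.map_comp, ← Spec.map_comp, hβ])
  have hl : l ≫ j = Spec.map q ≫ e.inv := hZ.lift_fst _ _ _
  have hq : θ ≫ q = q := by
    apply Spec.map_injective
    rw [Spec.map_comp, hθ, ← reassoc_of% hl, reassoc_of% hj, reassoc_of% hl]
    simp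
  have hb := bijective_of_sub_mem_map_of_isNilpotent (A := A) (C := C) hJ
    { θ.hom with commutes' := fun a ↦ congr($hαθ a) } fun c ↦ by
      rw [← Ideal.Quotient.eq_zero_iff_mem, map_sub, sub_eq_zero]
      exact congr($hq c)
  have : IsIso θ := (ConcreteCategory.isIso_iff_bijective θ).2 hb
  have : Θ = e.hom ≫ Spec.map θ ≫ e.inv := by simp [hθ]
  rw [this]
  infer_instance

end Thickening

/-! ### Open subschemes over a field -/

section OpenSubschemes

variable {k : Type u} [Field k] {X : Over (Spec (.of k))} {U : X.left.Opens}

instance openSubι_mono : Mono (openSubι X U) :=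
  have : Mono (openSubι X U).left := inferInstanceAs (Mono U.ι)
  Over.mono_of_mono_left _

/-- A morphism that lands in the open subset `U`, as a morphism to the open subscheme `U`. -/
noncomputable def openLift {T : Over (Spec (.of k))} (f : T ⟶ X) (hf : ∀ t, f.left t ∈ U) :
    T ⟶ openSub X U :=
  Over.homMk (IsOpenImmersion.lift U.ι f.left (by rintro _ ⟨t, rfl⟩; simpa using hf t)) (by
    exact (IsOpenImmersion.lift_fac_assoc _ _ _ _).trans (Over.w f))

lemma openLift_ι {T : Over (Spec (.of k))} (f : T ⟶ X) (hf : ∀ t, f.left t ∈ U) :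
    openLift f hf ≫ openSubι X U = f := by
  ext1
  exact IsOpenImmersion.lift_fac _ _ _

end OpenSubschemes

/-! ### Points infinitely near the identity -/

section InfinitesimalUnits

variable {k : Type u} [Field k] {S : Over (Spec (.of k))} [MonObj S]

/-- Let `i` be the inclusion of a `k`-point in an infinitesimal thickening `T`. A `T`-valued point
`τ` of `S` that reduces to `1` has a right inverse that reduces to `1`: left translation by `τ` on
the product of `T` with an affine neighbourhood `W` of `1` restricts to the identity over the
`k`-point, so it is an automorphism of `T ⊗ W`, and the inverse image of the section `1` is the
right inverse of `τ`. -/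
lemma exists_mul_eq_one_of_comp_eq_one {T : Over (Spec (.of k))}
    (i : 𝟙_ (Over (Spec (.of k))) ⟶ T)
    (hsurj : ∀ W : Over (Spec (.of k)), Function.Surjective (i ▷ W).left)
    (hiso : ∀ W : Over (Spec (.of k)), IsAffine W.left → ∀ Θ : T ⊗ W ⟶ T ⊗ W,
      Θ ≫ fst _ _ = fst _ _ → (i ▷ W) ≫ Θ = i ▷ W → IsIso Θ)
    (τ : T ⟶ S) (hτ : i ≫ τ = 1) :
    ∃ σ : T ⟶ S, i ≫ σ = 1 ∧ τ * σ = 1 := by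
  obtain ⟨W, hW, hxW, -⟩ := exists_isAffineOpen_mem_and_subset (X := S.left)
    (x := Points.pt η[S]) (U := ⊤) trivial
  let W' := openSub S W
  let ιW : W' ⟶ S := openSubι S W
  -- Left translation by `τ`, which maps into `W` because it does so over the `k`-point.
  let f : T ⊗ W' ⟶ S := (fst _ _ ≫ τ) * (snd _ _ ≫ ιW)
  have hf : (i ▷ W') ≫ f = snd _ _ ≫ ιW := by
    simp only [f, MonObj.comp_mul, whiskerRight_fst_assoc, hτ, MonObj.comp_one, one_mul,
      whiskerRight_snd_assoc]
  let ψ : T ⊗ W' ⟶ W' := openLift f fun x ↦ by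
    obtain ⟨z, rfl⟩ := hsurj W' x
    rw [← Scheme.Hom.comp_apply, ← Over.comp_left, hf]
    exact ((snd _ _ : 𝟙_ _ ⊗ W' ⟶ W').left z).2
  have hψ : ψ ≫ ιW = f := openLift_ι _ _
  have hiψ : (i ▷ W') ≫ ψ = snd _ _ := by
    rw [← cancel_mono ιW, Category.assoc, hψ, hf]
  let Θ : T ⊗ W' ⟶ T ⊗ W' := lift (fst _ _) ψ
  have hΘf : Θ ≫ fst _ _ = fst _ _ := by simp [Θ]
  have hΘψ : Θ ≫ snd _ _ = ψ := by simp [Θ]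
  have hiΘ : (i ▷ W') ≫ Θ = i ▷ W' := by
    apply CartesianMonoidalCategory.hom_ext
    · rw [Category.assoc, hΘf]
    · rw [Category.assoc, hΘψ, hiψ, whiskerRight_snd]
  have : IsIso Θ := hiso W' hW Θ hΘf hiΘ
  let e : 𝟙_ _ ⟶ W' := openLift η[S] fun t ↦ by
    rwa [Subsingleton.elim (α := PrimeSpectrum k) t (IsLocalRing.closedPoint k)]
  have he : e ≫ ιW = η := openLift_ι _ _
  let c : T ⟶ T ⊗ W' := lift (𝟙 T) (toUnit _ ≫ e)
  have hic : i ≫ c = (lift (𝟙 _) e) ≫ (i ▷ W') := by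
    apply CartesianMonoidalCategory.hom_ext <;> simp [c]
  have hicΘ : i ≫ c ≫ inv Θ = i ≫ c := by
    rw [← Category.assoc, IsIso.comp_inv_eq, hic, Category.assoc, hiΘ]
  refine ⟨c ≫ inv Θ ≫ snd _ _ ≫ ιW, ?_, ?_⟩
  · rw [reassoc_of% hicΘ]
    simp [c, he, Hom.one_def]
  · have h0 : inv Θ ≫ fst _ _ = fst _ _ := by rw [IsIso.inv_comp_eq, hΘf]
    have h1 : τ = (c ≫ inv Θ) ≫ fst _ _ ≫ τ := by
      rw [Category.assoc, reassoc_of% h0]; simp [c]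
    calc τ * c ≫ inv Θ ≫ snd _ _ ≫ ιW
        = (c ≫ inv Θ) ≫ f := by
          rw [MonObj.comp_mul, ← h1, Category.assoc]
      _ = 1 := by
        rw [← hψ, ← hΘψ]
        simp [c, he, Hom.one_def]

/-- A point of `S` with values in an infinitesimal thickening of a `k`-point that reduces to `1`
is a unit. -/
lemma isUnit_of_comp_eq_one {A : CommRingCat.{u}} {h : Spec A ⟶ Spec (.of k)} {φ : A ⟶ .of k}
    (hJ : IsNilpotent (RingHom.ker φ.hom))
    (i : 𝟙_ (Over (Spec (.of k))) ⟶ Over.mk h) (hi : i.left = Spec.map φ)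
    (τ : Over.mk h ⟶ S) (hτ : i ≫ τ = 1) : IsUnit τ := by
  have hpb (W : Over (Spec (.of k))) :
      IsPullback (i ▷ W).left (fst (𝟙_ _) W).left (fst (Over.mk h) W).left (Spec.map φ) := by
    rw [← hi]
    refine IsPullback.of_right (h₁₂ := (snd (Over.mk h) W).left) (v₁₃ := W.hom) (h₂₂ := h) ?_ ?_
      (IsPullback.of_hasPullback _ _).flip
    · rw [← Over.comp_left, whiskerRight_snd, show i.left ≫ h = 𝟙 _ from Over.w i]
      exact (IsPullback.of_hasPullback _ _).flip
    · rw [← Over.comp_left, ← Over.comp_left, whiskerRight_fst]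
  have hφ : Function.Surjective φ.hom := by
    obtain ⟨α, hα⟩ := Spec.map_surjective h
    have h1 : α ≫ φ = 𝟙 _ := Spec.map_injective (by
      rw [Spec.map_comp, hα, ← hi, Spec.map_id]
      exact Over.w i)
    exact fun x ↦ ⟨α.hom x, congr($h1 x)⟩
  have hsurj (W : Over (Spec (.of k))) : Function.Surjective (i ▷ W).left := by
    have : Surjective (Spec.map φ) := by
      obtain ⟨n, hn⟩ := hJ
      refine ⟨Set.range_eq_univ.1 ((range_comap_of_surjective _ φ.hom hφ).trans
        ((PrimeSpectrum.zeroLocus_eq_univ_iff _).2 fun x hx ↦ ⟨n, ?_⟩))⟩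
      simpa [hn] using Ideal.pow_mem_pow hx n
    have : Surjective (i ▷ W).left :=
      MorphismProperty.of_isPullback (P := @Surjective) (hpb W).flip inferInstance
    exact (i ▷ W).left.surjective
  have hiso : ∀ W : Over (Spec (.of k)), IsAffine W.left → ∀ Θ : Over.mk h ⊗ W ⟶ Over.mk h ⊗ W,
      Θ ≫ fst _ _ = fst _ _ → (i ▷ W) ≫ Θ = i ▷ W → IsIso Θ := by
    intro W hW Θ h1 h2
    have : IsAffine (Over.mk h ⊗ W).left := by
      change IsAffine (pullback h W.hom)
      infer_instance
    have : IsIso Θ.left := isIso_of_isPullback_of_isNilpotent (hpb W) hφ hJ Θ.left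
      (by rw [← Over.comp_left, h1]) (by rw [← Over.comp_left, h2])
    have : IsIso ((Over.forget _).map Θ) := this
    exact CategoryTheory.isIso_of_reflects_iso Θ (Over.forget _)
  obtain ⟨σ, hσ, hτσ⟩ := exists_mul_eq_one_of_comp_eq_one i hsurj hiso τ hτ
  -- The right inverse `σ` also reduces to `1`, so it has a right inverse, which must be `τ`.
  obtain ⟨ρ, -, hσρ⟩ := exists_mul_eq_one_of_comp_eq_one i hsurj hiso σ hσ
  have : ρ = τ := by rw [← one_mul ρ, ← hτσ, mul_assoc, hσρ, mul_one]
  exact ⟨⟨τ, σ, hτσ, this ▸ hσρ⟩, rfl⟩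

end InfinitesimalUnits

/-! ### The object of units of a monoid object -/

section UnitObject

variable {C : Type*} [Category* C] [CartesianMonoidalCategory C]

lemma isUnit_comp {S : C} [MonObj S] {T T' : C} {τ : T ⟶ S} (hτ : IsUnit τ) (f : T' ⟶ T) :
    IsUnit (f ≫ τ) := by
  obtain ⟨⟨τ, σ, h1, h2⟩, rfl⟩ := hτ
  exact ⟨⟨f ≫ τ, f ≫ σ, by rw [← MonObj.comp_mul, h1, MonObj.comp_one],
    by rw [← MonObj.comp_mul, h2, MonObj.comp_one]⟩, rfl⟩

variable [HasEqualizers C]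

/-- The object of units of a monoid object `S`: the subobject of `S ⊗ S` of pairs `(x, y)` with
`x * y = 1` and `y * x = 1`. -/
noncomputable def unitObj (S : C) [MonObj S] : C :=
  equalizer (lift (fst S S * snd S S) (snd S S * fst S S)) (lift 1 1)

/-- The inclusion of the object of units of `S` in `S ⊗ S`. -/
noncomputable def unitPair (S : C) [MonObj S] : unitObj S ⟶ S ⊗ S :=
  equalizer.ι _ _

/-- The inclusion `(x, y) ↦ x` of the object of units of `S` in `S`. -/
noncomputable def unitι (S : C) [MonObj S] : unitObj S ⟶ S :=
  unitPair S ≫ fst S S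

variable {S : C} [MonObj S]

lemma unitι_mul_snd : unitι S * (unitPair S ≫ snd S S) = 1 := by
  have h : unitPair S ≫ _ = unitPair S ≫ _ := equalizer.condition _ _
  simpa [unitι, MonObj.comp_mul] using congr($h ≫ fst _ _)

lemma snd_mul_unitι : (unitPair S ≫ snd S S) * unitι S = 1 := by
  have h : unitPair S ≫ _ = unitPair S ≫ _ := equalizer.condition _ _
  simpa [unitι, MonObj.comp_mul] using congr($h ≫ snd _ _)

/-- The object of units represents the functor of units of `S`. -/
lemma isUnit_iff_exists_comp_unitι {T : C} (τ : T ⟶ S) :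
    IsUnit τ ↔ ∃ t : T ⟶ unitObj S, t ≫ unitι S = τ := by
  constructor
  · rintro ⟨⟨τ, σ, h1, h2⟩, rfl⟩
    let t : T ⟶ unitObj S := equalizer.lift (lift τ σ) (by simp [MonObj.comp_mul, h1, h2])
    have ht : t ≫ unitPair S = lift τ σ := equalizer.lift_ι _ _
    exact ⟨t, by rw [unitι, reassoc_of% ht, lift_fst]⟩
  · rintro ⟨t, rfl⟩
    exact isUnit_comp ⟨⟨unitι S, unitPair S ≫ snd S S, unitι_mul_snd, snd_mul_unitι⟩, rfl⟩ t

instance mono_unitι : Mono (unitι S) := by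
  constructor
  intro Z f g h
  have : Mono (unitPair S) :=
    inferInstanceAs (Mono (equalizer.ι (lift (fst S S * snd S S) (snd S S * fst S S)) (lift 1 1)))
  rw [← cancel_mono (unitPair S)]
  apply CartesianMonoidalCategory.hom_ext
  · simpa only [Category.assoc] using! h
  · have hf : (f ≫ unitPair S ≫ snd S S) * (f ≫ unitι S) = 1 := by
      rw [← MonObj.comp_mul, snd_mul_unitι, MonObj.comp_one]
    have hg : (g ≫ unitι S) * (g ≫ unitPair S ≫ snd S S) = 1 := by
      rw [← MonObj.comp_mul, unitι_mul_snd, MonObj.comp_one]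
    rw [h] at hf
    simpa only [Category.assoc] using left_inv_eq_right_inv hf hg

end UnitObject

/-! ### The units are dense -/

section Dominance

variable {k : Type u} [Field k] {S : Over (Spec (.of k))} [MonObj S]

section

variable [IsSeparated S.hom] [LocallyOfFiniteType S.hom] [QuasiCompact S.hom]

instance unitPair_left_isClosedImmersion : IsClosedImmersion (unitPair S).left := by
  have : IsSeparated (S ⊗ S).hom :=
    inferInstanceAs (IsSeparated (pullback.fst S.hom S.hom ≫ S.hom))
  exact inferInstanceAs (IsClosedImmersion
    (equalizer.ι (lift (fst S S * snd S S) (snd S S * fst S S)) (lift 1 1)).left)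

instance unitι_left_locallyOfFiniteType : LocallyOfFiniteType (unitι S).left := by
  have : LocallyOfFiniteType (fst S S).left :=
    inferInstanceAs (LocallyOfFiniteType (pullback.fst S.hom S.hom))
  rw [unitι, Over.comp_left]
  infer_instance

instance unitι_left_quasiCompact : QuasiCompact (unitι S).left := by
  have : QuasiCompact (fst S S).left :=
    inferInstanceAs (QuasiCompact (pullback.fst S.hom S.hom))
  rw [unitι, Over.comp_left]
  infer_instance

end

/-- A morphism from the spectrum of a local ring factors through the spectrum of the local ring at
the image of the closed point. -/
lemma exists_specMap_comp_fromSpecStalk {R : CommRingCat.{u}} [IsLocalRing R] {Y : Scheme.{u}}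
    (f : Spec R ⟶ Y) {y : Y} (hy : f (IsLocalRing.closedPoint R) = y) :
    ∃ ψ : Y.presheaf.stalk y ⟶ R, f = Spec.map ψ ≫ Y.fromSpecStalk y := by
  subst hy
  exact ⟨Scheme.stalkClosedPointTo f, (Scheme.Spec_stalkClosedPointTo_fromSpecStalk f).symm⟩

/-- A morphism to an integral scheme that is injective on some local ring is dominant. -/
lemma mem_range_of_injective_stalkMap {X Y : Scheme.{u}} [IsIntegral Y] (f : X ⟶ Y) (x : X)
    (h : Function.Injective (f.stalkMap x)) : genericPoint Y ∈ Set.range f := by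
  let y := f x
  have hgen : genericPoint Y ∈ Set.range (Y.fromSpecStalk y) := by
    rw [Scheme.range_fromSpecStalk]
    exact genericPoint_specializes y
  obtain ⟨q, hq⟩ := hgen
  let o : Spec (Y.presheaf.stalk y) := ⟨⊥, Ideal.isPrime_bot⟩
  have ho : Y.fromSpecStalk y o = genericPoint Y := by
    refine (Specializes.antisymm ?_ (genericPoint_specializes (Y.fromSpecStalk y o))).eq
    rw [← hq]
    exact ((PrimeSpectrum.le_iff_specializes o q).1 bot_le).map (Y.fromSpecStalk y).continuous
  obtain ⟨p', hp', hp⟩ := Ideal.exists_comap_eq_of_mem_minimalPrimes_of_injective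
    (f := (f.stalkMap x).hom) h ⊥ (by
      rw [IsDomain.minimalPrimes_eq_singleton_bot]; rfl)
  let P : Spec (X.presheaf.stalk x) := ⟨p', hp'⟩
  have h1 : Spec.map (f.stalkMap x) P = o := PrimeSpectrum.ext hp
  refine ⟨X.fromSpecStalk x P, ?_⟩
  rw [← Scheme.Hom.comp_apply, ← Scheme.SpecMap_stalkMap_fromSpecStalk, Scheme.Hom.comp_apply, h1,
    ho]

/-- A homomorphism from a truncation of a local ring to a field has nilpotent kernel. -/
lemma isNilpotent_ker_quotient_lift {R K : Type*} [CommRing R] [IsLocalRing R] [Field K]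
    (ε : R →+* K) (n : ℕ)
    (h : ∀ a ∈ IsLocalRing.maximalIdeal R ^ n, ε a = 0) :
    IsNilpotent (RingHom.ker (Ideal.Quotient.lift (IsLocalRing.maximalIdeal R ^ n) ε h)) := by
  refine ⟨n, ?_⟩
  have hε : RingHom.ker ε ≤ IsLocalRing.maximalIdeal R :=
    IsLocalRing.le_maximalIdeal (RingHom.ker_ne_top ε)
  have hker : RingHom.ker (Ideal.Quotient.lift (IsLocalRing.maximalIdeal R ^ n) ε h) =
      (RingHom.ker ε).map (Ideal.Quotient.mk _) := Ideal.ker_quotient_lift ε h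
  rw [hker, ← Ideal.map_pow, Ideal.zero_eq_bot, ← le_bot_iff,
    ← Ideal.map_quotient_self (IsLocalRing.maximalIdeal R ^ n)]
  exact Ideal.map_mono (Ideal.pow_right_mono hε n)

variable [LocallyOfFiniteType S.hom]

/-- The inclusion of the units is injective on local rings at `1`. The truncations of the local ring
of `S` at `1` define points of `S` with values in infinitesimal thickenings of `1`, which are
units; so an element of the local ring that vanishes on the scheme of units lies in every power of
the maximal ideal. -/
lemma exists_injective_stalkMap_unitι :
    ∃ x, Function.Injective ((unitι S).left.stalkMap x) := by
  obtain ⟨t, ht⟩ := (isUnit_iff_exists_comp_unitι (1 : 𝟙_ (Over (Spec (.of k))) ⟶ S)).1 isUnit_one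
  let t' : Spec (.of k) ⟶ (unitObj S).left := t.left
  let x := t' (IsLocalRing.closedPoint k)
  let p := (unitι S).left
  let R := S.left.presheaf.stalk (p x)
  have : IsLocallyNoetherian S.left :=
    LocallyOfFiniteType.isLocallyNoetherian (Y := Spec (.of k)) S.hom
  refine ⟨x, (injective_iff_map_eq_zero _).2 fun f hf ↦ ?_⟩
  let ε : R ⟶ .of k := p.stalkMap x ≫ Scheme.stalkClosedPointTo t'
  have hεloc : IsLocalHom ε.hom :=
    have := Scheme.isLocalHom_stalkClosedPointTo' t'
    RingHom.isLocalHom_comp (Scheme.stalkClosedPointTo t').hom (p.stalkMap x).hom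
  have hε : Spec.map ε ≫ S.left.fromSpecStalk (p x) = (1 : 𝟙_ (Over (Spec (.of k))) ⟶ S).left := by
    rw [← ht, Spec.map_comp, Category.assoc, Scheme.SpecMap_stalkMap_fromSpecStalk]
    exact Scheme.Spec_stalkClosedPointTo_fromSpecStalk_assoc t' p
  -- By Krull's intersection theorem it suffices that `f` vanishes in every truncation `A`.
  have hf' : f ∈ (⨅ n : ℕ, IsLocalRing.maximalIdeal R ^ n) := by
    refine Ideal.mem_iInf.2 fun n ↦ ?_
    refine Ideal.pow_le_pow_right n.le_succ ?_
    let I := IsLocalRing.maximalIdeal R ^ (n + 1)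
    let A := CommRingCat.of (R ⧸ I)
    let q : R ⟶ A := CommRingCat.ofHom (Ideal.Quotient.mk I)
    have hI : I ≤ IsLocalRing.maximalIdeal R := Ideal.pow_le_self n.succ_ne_zero
    have hIε : ∀ a ∈ I, ε.hom a = 0 := fun a ha ↦ by
      by_contra h0
      exact (hI ha) (isUnit_of_map_unit ε.hom a (isUnit_iff_ne_zero.2 h0))
    have : Nontrivial A := Ideal.Quotient.nontrivial_iff.2
      ((lt_of_le_of_lt hI (IsLocalRing.maximalIdeal.isMaximal R).ne_top.lt_top).ne)
    have : IsLocalRing A := .of_surjective' _ Ideal.Quotient.mk_surjective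
    let j := Spec.map q ≫ S.left.fromSpecStalk (p x)
    let h := j ≫ S.hom
    let τ : Over.mk h ⟶ S := Over.homMk j
    let φ : A ⟶ .of k := CommRingCat.ofHom (Ideal.Quotient.lift I ε.hom hIε)
    have hφ : q ≫ φ = ε := by ext; rfl
    have hφloc : IsLocalHom φ.hom := ⟨fun a ha ↦ by
      obtain ⟨r, rfl⟩ := Ideal.Quotient.mk_surjective a
      exact (isUnit_of_map_unit ε.hom r ha).map (Ideal.Quotient.mk I)⟩
    have hφj : Spec.map φ ≫ j = (1 : 𝟙_ (Over (Spec (.of k))) ⟶ S).left := by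
      rw [← hε, ← hφ, Spec.map_comp, Category.assoc]
    let i : 𝟙_ (Over (Spec (.of k))) ⟶ Over.mk h := Over.homMk (Spec.map φ) (by
      change Spec.map φ ≫ j ≫ S.hom = _
      rw [reassoc_of% hφj]
      exact Over.w _)
    have hiτ : i ≫ τ = 1 := by
      ext1
      exact hφj
    obtain ⟨t₁, ht₁⟩ := (isUnit_iff_exists_comp_unitι τ).1
      (isUnit_of_comp_eq_one (isNilpotent_ker_quotient_lift ε.hom (n + 1) hIε) i rfl τ hiτ)
    have hit : i ≫ t₁ = t := by
      rw [← cancel_mono (unitι S), Category.assoc, ht₁, hiτ, ht]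
    obtain ⟨ψ, hψ⟩ := exists_specMap_comp_fromSpecStalk (R := A) t₁.left (y := x) (by
      have h1 : Spec.map φ (IsLocalRing.closedPoint k) = IsLocalRing.closedPoint A :=
        IsLocalRing.comap_closedPoint φ.hom
      rw [← h1]
      exact congr(($hit).left (IsLocalRing.closedPoint k)))
    -- The truncation map factors through the local ring of the scheme of units, where `f` vanishes.
    have hq : p.stalkMap x ≫ ψ = q := by
      apply Spec.map_injective
      rw [← cancel_mono (S.left.fromSpecStalk (p x)), Spec.map_comp, Category.assoc,
        Scheme.SpecMap_stalkMap_fromSpecStalk, ← reassoc_of% hψ]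
      exact congr(($ht₁).left)
    rw [← Ideal.Quotient.eq_zero_iff_mem]
    refine (congr($hq f)).symm.trans ?_
    rw [CommRingCat.comp_apply, hf, map_zero]
  rw [Ideal.iInf_pow_eq_bot_of_isLocalRing _ (IsLocalRing.maximalIdeal.isMaximal R).ne_top] at hf'
  exact hf'

variable [IsReduced S.left] [IrreducibleSpace S.left]

lemma genericPoint_mem_range_unitι :
    genericPoint S.left ∈ Set.range (unitι S).left := by
  obtain ⟨x, hx⟩ := exists_injective_stalkMap_unitι (S := S)
  have : IsIntegral S.left := isIntegral_of_irreducibleSpace_of_isReduced S.left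
  exact mem_range_of_injective_stalkMap _ x hx

/-- The inclusion of the units is an isomorphism over some nonempty open subset. -/
lemma exists_isUnit_openSubι [IsSeparated S.hom] [QuasiCompact S.hom] :
    ∃ V : S.left.Opens, (V : Set S.left).Nonempty ∧ IsUnit (openSubι S V) := by
  have : IsIntegral S.left := isIntegral_of_irreducibleSpace_of_isReduced S.left
  let p := (unitι S).left
  let ξ := genericPoint S.left
  have : Mono p := Over.mono_left_of_mono _
  let π := pullback.snd p (S.left.fromSpecStalk ξ)
  have : Subsingleton (Spec (S.left.presheaf.stalk ξ)) :=
    inferInstanceAs (Subsingleton (PrimeSpectrum S.left.functionField))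
  have : Surjective π := by
    refine ⟨Set.range_eq_univ.1 ?_⟩
    rw [Scheme.Pullback.range_snd]
    refine Set.eq_univ_of_forall fun z ↦ ?_
    rw [Subsingleton.elim z (IsLocalRing.closedPoint _)]
    change S.left.fromSpecStalk ξ (IsLocalRing.closedPoint _) ∈ Set.range p
    rw [Scheme.fromSpecStalk_closedPoint]
    exact genericPoint_mem_range_unitι
  have : IsIso π := Flat.isIso_of_surjective_of_mono π
  -- The inverse of `π` is a section of `p` over the generic point, which extends to an open subset.
  obtain ⟨V, hV, f, -, hf⟩ := spread_out_of_isGermInjective' (𝟙 S.left) p (x := ξ)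
    (inv π ≫ pullback.fst _ _) (by
      rw [Category.assoc, IsIso.inv_comp_eq, pullback.condition]
      simp [π])
  refine ⟨V, ⟨ξ, hV⟩, ?_⟩
  rw [isUnit_iff_exists_comp_unitι]
  refine ⟨Over.homMk f ?_, ?_⟩
  · change f ≫ (unitObj S).hom = V.ι ≫ S.hom
    rw [← Over.w (unitι S), reassoc_of% hf]
  · ext1
    simpa using hf

end Dominance

/-! ### Subobjects of units are group objects -/

section GroupOfUnits

variable {C : Type*} [Category* C] [CartesianMonoidalCategory C] {G S : C} [MonObj S]

/-- A subobject `i : G ⟶ S` of a monoid object that contains `1`, is closed under multiplication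
and consists of units whose inverses are again in `G`, as a group object. -/
@[reducible] def grpObjOfMono (i : G ⟶ S) [Mono i] (e : 𝟙_ C ⟶ G) (he : e ≫ i = 1)
    (m : G ⊗ G ⟶ G) (hm : m ≫ i = (fst G G ≫ i) * (snd G G ≫ i))
    (v : G ⟶ G) (hv : (v ≫ i) * i = 1) (hv' : i * (v ≫ i) = 1) : GrpObj G where
  one := e
  mul := m
  one_mul := by
    rw [← cancel_mono i, Category.assoc, hm, MonObj.comp_mul, whiskerRight_fst_assoc,
      whiskerRight_snd_assoc, he, MonObj.comp_one, one_mul, leftUnitor_hom]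
  mul_one := by
    rw [← cancel_mono i, Category.assoc, hm, MonObj.comp_mul, whiskerLeft_fst_assoc,
      whiskerLeft_snd_assoc, he, MonObj.comp_one, mul_one, rightUnitor_hom]
  mul_assoc := by
    rw [← cancel_mono i]
    simp only [Category.assoc, hm, MonObj.comp_mul, whiskerRight_fst_assoc, whiskerRight_snd_assoc,
      whiskerLeft_fst_assoc, whiskerLeft_snd_assoc, associator_hom_fst_assoc,
      associator_hom_snd_fst_assoc, associator_hom_snd_snd_assoc, mul_assoc]
  inv := v
  left_inv := by
    rw [← cancel_mono i, Category.assoc, hm, MonObj.comp_mul, lift_fst_assoc, lift_snd_assoc,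
      Category.id_comp, hv, Category.assoc, he, MonObj.comp_one]
  right_inv := by
    rw [← cancel_mono i, Category.assoc, hm, MonObj.comp_mul, lift_fst_assoc, lift_snd_assoc,
      Category.id_comp, hv', Category.assoc, he, MonObj.comp_one]

lemma isMonHom_grpObjOfMono (i : G ⟶ S) [Mono i] (e : 𝟙_ C ⟶ G) (he : e ≫ i = 1)
    (m : G ⊗ G ⟶ G) (hm : m ≫ i = (fst G G ≫ i) * (snd G G ≫ i))
    (v : G ⟶ G) (hv : (v ≫ i) * i = 1) (hv' : i * (v ≫ i) = 1) :
    letI := grpObjOfMono i e he m hm v hv hv'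
    IsMonHom i :=
  letI := grpObjOfMono i e he m hm v hv hv'
  { one_hom := he.trans (MonObj.one_eq_one S).symm
    mul_hom := by
      change m ≫ i = _
      rw [hm, MonObj.mul_eq_mul, MonObj.comp_mul]
      simp }

/-- If the morphisms to `S` that factor through the subobject `i : G ⟶ S` are, for all sources
satisfying `P`, precisely the units, then `G` is a group object and `i` is a homomorphism. -/
lemma exists_grpObj_isMonHom (P : C → Prop) (h1 : P (𝟙_ C)) (hG : P G) (hGG : P (G ⊗ G))
    (i : G ⟶ S) [Mono i] (hi : IsUnit i)
    (h : ∀ T, P T → ∀ τ : T ⟶ S, IsUnit τ → ∃ t : T ⟶ G, t ≫ i = τ) :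
    ∃ _ : GrpObj G, IsMonHom i := by
  obtain ⟨e, he⟩ := h _ h1 1 isUnit_one
  obtain ⟨m, hm⟩ := h _ hGG ((fst G G ≫ i) * (snd G G ≫ i))
    ((isUnit_comp hi _).mul (isUnit_comp hi _))
  obtain ⟨u, hu⟩ := hi
  obtain ⟨v, hv⟩ := h _ hG (u⁻¹ : (G ⟶ S)ˣ) (Units.isUnit _)
  have h1 : (v ≫ i) * i = 1 := by rw [hv, ← hu, Units.inv_mul]
  have h2 : i * (v ≫ i) = 1 := by rw [hv, ← hu, Units.mul_inv]
  exact ⟨grpObjOfMono i e he m hm v h1 h2, isMonHom_grpObjOfMono i e he m hm v h1 h2⟩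

end GroupOfUnits

lemma mem_unitSet_iff {M : Type*} [Monoid M] {g : M} : g ∈ unitSet M ↔ IsUnit g :=
  ⟨fun ⟨g', h1, h2⟩ ↦ ⟨⟨g, g', h1, h2⟩, rfl⟩, fun ⟨u, hu⟩ ↦ ⟨(u⁻¹ : Mˣ), by simp [← hu]⟩⟩

/-! ### The open subset of units -/

section UnitOpen

variable {k : Type u} [Field k] {S : Over (Spec (.of k))} [MonObj S]

/-- The open subset of units of `S`: the largest open subset whose inclusion in `S` is a unit of the
monoid of its points. -/
noncomputable def unitOpens (S : Over (Spec (.of k))) [MonObj S] : S.left.Opens :=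
  ⨆ W : {W : S.left.Opens // IsUnit (openSubι S W)}, W.1

lemma le_unitOpens {W : S.left.Opens} (hW : IsUnit (openSubι S W)) : W ≤ unitOpens S :=
  le_iSup (fun W : {W : S.left.Opens // IsUnit (openSubι S W)} ↦ W.1) ⟨W, hW⟩

/-- A morphism that factors locally through a monomorphism factors through it. -/
lemma exists_comp_eq_of_openCover {X Y Z : Scheme.{u}} (𝒰 : X.OpenCover) (g : X ⟶ Z) (p : Y ⟶ Z)
    [Mono p] (h : ∀ i, ∃ t, t ≫ p = 𝒰.f i ≫ g) : ∃ s, s ≫ p = g := by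
  choose t ht using h
  refine ⟨𝒰.glueMorphisms t fun i j ↦ ?_, Scheme.Cover.hom_ext 𝒰 _ _ fun i ↦ ?_⟩
  · rw [← cancel_mono p, Category.assoc, Category.assoc, ht, ht, pullback.condition_assoc]
  · rw [Scheme.Cover.ι_glueMorphisms_assoc, ht]

/-- The inverses on the members of a family of opens glue, because inverses are unique. -/
lemma isUnit_openSubι_unitOpens : IsUnit (openSubι S (unitOpens S)) := by
  have hmono : Mono (unitι S).left := Over.mono_left_of_mono _
  obtain ⟨s, hs⟩ := exists_comp_eq_of_openCover
    (Scheme.Opens.iSupOpenCover fun W : {W : S.left.Opens // IsUnit (openSubι S W)} ↦ W.1)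
    (unitOpens S).ι (unitι S).left fun W ↦ by
      obtain ⟨t, ht⟩ := (isUnit_iff_exists_comp_unitι _).1 W.2
      exact ⟨t.left, congr(($ht).left).trans (S.left.homOfLE_ι (le_unitOpens W.2)).symm⟩
  refine (isUnit_iff_exists_comp_unitι _).2 ⟨Over.homMk s ?_, ?_⟩
  · change s ≫ (unitObj S).hom = (unitOpens S).ι ≫ S.hom
    rw [← Over.w (unitι S), reassoc_of% hs]
    rfl
  · ext1
    exact hs

/-- Left translation of `S` by the `k`-point `c`. -/
noncomputable def mulLeftHom (c : Points S) : S ⟶ S := (toUnit S ≫ c) * 𝟙 S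

lemma comp_mulLeftHom {T : Over (Spec (.of k))} (f : T ⟶ S) (c : Points S) :
    f ≫ mulLeftHom c = (toUnit T ≫ c) * f := by
  simp [mulLeftHom, MonObj.comp_mul]

lemma point_comp_mulLeftHom (p c : Points S) : p ≫ mulLeftHom c = c * p := by
  rw [comp_mulLeftHom, toUnit_unique (toUnit _) (𝟙 _), Category.id_comp]

/-- Right translation of `S` by the `k`-point `c`. -/
noncomputable def mulRightHom (c : Points S) : S ⟶ S := 𝟙 S * (toUnit S ≫ c)

lemma point_comp_mulRightHom (p c : Points S) : p ≫ mulRightHom c = p * c := by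
  rw [mulRightHom, MonObj.comp_mul, Category.comp_id, ← Category.assoc,
    toUnit_unique (p ≫ toUnit _) (𝟙 _), Category.id_comp]

lemma nonempty_unitOpens [LocallyOfFiniteType S.hom] [IsReduced S.left] [IrreducibleSpace S.left]
    [IsSeparated S.hom] [QuasiCompact S.hom] :
    ((unitOpens S : S.left.Opens) : Set S.left).Nonempty := by
  obtain ⟨V, hV, hVu⟩ := exists_isUnit_openSubι (S := S)
  exact hV.mono (le_unitOpens hVu)

variable [IsAlgClosed k] [LocallyOfFiniteType S.hom]

/-- A unit of `S(k)` lies in the open subset of units, being in a translate of a given nonempty open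
set of units. -/
lemma pt_mem_unitOpens_of_isUnit {V : S.left.Opens} (hV : (V : Set S.left).Nonempty)
    (hVu : IsUnit (openSubι S V)) {g : Points S} (hg : IsUnit g) : g.pt ∈ unitOpens S := by
  obtain ⟨v, hv⟩ := Points.exists_pt_mem V.isOpen.isLocallyClosed hV
  have hvu : IsUnit v := by
    rw [← openLift_ι (U := V) v fun t ↦ by
      rwa [Subsingleton.elim (α := PrimeSpectrum k) t (IsLocalRing.closedPoint k)]]
    exact isUnit_comp hVu _
  obtain ⟨g, rfl⟩ := hg
  obtain ⟨v, rfl⟩ := hvu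
  -- The translate `W = c * V` contains `g = c * v`; it is the preimage of `V` under translation by
  -- `c⁻¹`.
  let c : (Points S)ˣ := g * v⁻¹
  let W : S.left.Opens := (mulLeftHom (c⁻¹ : (Points S)ˣ).1).left ⁻¹ᵁ V
  have hW : IsUnit (openSubι S W) := by
    have h1 : IsUnit (openSubι S W ≫ mulLeftHom (c⁻¹ : (Points S)ˣ).1) := by
      rw [← openLift_ι (U := V) (openSubι S W ≫ mulLeftHom (c⁻¹ : (Points S)ˣ).1) fun t ↦ t.2]
      exact isUnit_comp hVu _
    have h2 : openSubι S W = (toUnit _ ≫ c.1) * (openSubι S W ≫ mulLeftHom (c⁻¹).1) := by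
      rw [comp_mulLeftHom, ← mul_assoc, ← MonObj.comp_mul, Units.mul_inv, MonObj.comp_one, one_mul]
    rw [h2]
    exact (isUnit_comp c.isUnit _).mul h1
  refine le_unitOpens hW ?_
  change (mulLeftHom (c⁻¹ : (Points S)ˣ).1).left g.1.pt ∈ V
  rw [← Points.pt_comp, point_comp_mulLeftHom]
  simpa [c] using hv

variable [IsReduced S.left] [IrreducibleSpace S.left] [IsSeparated S.hom] [QuasiCompact S.hom]

lemma pt_mem_unitOpens_iff {g : Points S} : g.pt ∈ unitOpens S ↔ IsUnit g := by
  refine ⟨fun hg ↦ ?_, pt_mem_unitOpens_of_isUnit nonempty_unitOpens isUnit_openSubι_unitOpens⟩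
  rw [← openLift_ι (U := unitOpens S) g fun t ↦ by
    rwa [Subsingleton.elim (α := PrimeSpectrum k) t (IsLocalRing.closedPoint k)]]
  exact isUnit_comp isUnit_openSubι_unitOpens _

/-- A unit with values in a scheme locally of finite type factors through the open subset of units,
since it does so on `k`-points. -/
lemma exists_comp_openSubι_eq_of_isUnit {T : Over (Spec (.of k))} [LocallyOfFiniteType T.hom]
    {τ : T ⟶ S} (hτ : IsUnit τ) : ∃ t, t ≫ openSubι S (unitOpens S) = τ := by
  refine ⟨openLift τ fun t ↦ ?_, openLift_ι _ _⟩
  by_contra ht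
  obtain ⟨p, hp⟩ := Points.exists_pt_mem (X := T)
    ((unitOpens S).isOpen.isClosed_compl.preimage τ.left.continuous).isLocallyClosed ⟨t, ht⟩
  refine hp ?_
  rw [← Points.pt_comp]
  exact pt_mem_unitOpens_iff.2 (isUnit_comp hτ p)

variable (S) in
lemma exists_grpObj_unitOpens :
    ∃ _ : GrpObj (openSub S (unitOpens S)), IsMonHom (openSubι S (unitOpens S)) := by
  have hU : LocallyOfFiniteType (openSub S (unitOpens S)).hom :=
    inferInstanceAs (LocallyOfFiniteType ((unitOpens S).ι ≫ S.hom))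
  refine exists_grpObj_isMonHom (fun T ↦ LocallyOfFiniteType T.hom) ?_ hU ?_ _
    isUnit_openSubι_unitOpens fun T hT τ hτ ↦ exists_comp_openSubι_eq_of_isUnit hτ
  · exact inferInstanceAs (LocallyOfFiniteType (𝟙 _))
  · exact inferInstanceAs (LocallyOfFiniteType (pullback.fst _ _ ≫ (openSub S (unitOpens S)).hom))

end UnitOpen

/-! ### Unit orbits in topological monoids -/

section TopologicalMonoids

variable {M : Type*} [Monoid M]

/-- The orbit of `y` under left and right multiplication by units. -/
def unitOrbit (y : M) : Set M := {x | ∃ a b : Mˣ, a * y * b = x}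

lemma mem_unitOrbit_self (y : M) : y ∈ unitOrbit y := ⟨1, 1, by simp⟩

lemma mul_mul_mem_unitOrbit {x y : M} (hx : x ∈ unitOrbit y) (a b : Mˣ) :
    a * x * b ∈ unitOrbit y := by
  obtain ⟨c, d, rfl⟩ := hx
  exact ⟨a * c, d * b, by simp [mul_assoc]⟩

lemma unitOrbit_eq_of_mem {x y : M} (hx : x ∈ unitOrbit y) : unitOrbit x = unitOrbit y := by
  ext z
  constructor
  · rintro ⟨a, b, rfl⟩
    exact mul_mul_mem_unitOrbit hx a b
  · rintro ⟨a, b, rfl⟩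
    obtain ⟨c, d, rfl⟩ := hx
    exact ⟨a * c⁻¹, d⁻¹ * b, by simp [mul_assoc]⟩

variable [TopologicalSpace M]

/-- In a monoid with a Noetherian topology in which the sets `{x | c * x = x}` are closed, one-sided
inverses are two-sided: if `s * t = 1`, then the closed sets
`t ^ n * M = {x | t ^ n * s ^ n * x = x}` decrease, and `t * s = 1` follows once
they become stationary. -/
lemma mul_eq_one_symm_of_noetherianSpace [NoetherianSpace M]
    (hcl : ∀ c : M, IsClosed {x | c * x = x}) {s t : M} (h : s * t = 1) : t * s = 1 := by
  have hpow (n : ℕ) : s ^ n * t ^ n = 1 := by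
    induction n with
    | zero => simp
    | succ n ih => rw [pow_succ, pow_succ', mul_assoc, ← mul_assoc s t, h, one_mul, ih]
  let F (n : ℕ) : Closeds M := ⟨_, hcl (t ^ n * s ^ n)⟩
  have hF : ∀ n m, n ≤ m → F m ≤ F n := fun n m hnm x (hx : t ^ m * s ^ m * x = x) ↦ by
    obtain ⟨l, rfl⟩ := Nat.exists_eq_add_of_le hnm
    change t ^ n * s ^ n * x = x
    rw [← hx, pow_add t]
    simp only [← mul_assoc]
    rw [mul_assoc (t ^ n) (s ^ n), hpow, mul_one]
  obtain ⟨n, hn⟩ := WellFoundedGT.monotone_chain_condition (α := (Closeds M)ᵒᵈ)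
    ⟨fun n ↦ OrderDual.toDual (F n), hF⟩
  have h1 : t ^ n ∈ F n := by
    change t ^ n * s ^ n * t ^ n = t ^ n
    rw [mul_assoc, hpow, mul_one]
  have h2 : t ^ n ∈ F (n + 1) := by
    rwa [show F n = F (n + 1) from hn (n + 1) n.le_succ] at h1
  have h3 : t ^ (n + 1) * s = t ^ n := by
    have h2 : t ^ (n + 1) * s ^ (n + 1) * t ^ n = t ^ n := h2
    rwa [pow_succ' s, mul_assoc, mul_assoc s, hpow, mul_one] at h2
  calc t * s = s ^ n * (t ^ (n + 1) * s) := by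
        rw [pow_succ, ← mul_assoc, ← mul_assoc, hpow, one_mul]
    _ = 1 := by rw [h3, hpow]

lemma continuous_mul_mul
    (hL : ∀ c : M, Continuous (c * ·)) (hR : ∀ c : M, Continuous (· * c))
    (a b : M) : Continuous fun x ↦ a * x * b := (hR b).comp (hL a)

lemma mul_mul_mem_closure_unitOrbit
    (hL : ∀ c : M, Continuous (c * ·)) (hR : ∀ c : M, Continuous (· * c))
    {x y : M} (hx : x ∈ closure (unitOrbit y)) (a b : Mˣ) :
    a * x * b ∈ closure (unitOrbit y) :=
  map_mem_closure (f := fun x : M ↦ a * x * b) (continuous_mul_mul hL hR a b) hx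
    fun _ hz ↦ mul_mul_mem_unitOrbit hz a b

/-- If the units are dense, then a closed set containing the orbit of `y` contains `M * y * M`. -/
lemma mul_mul_mem_of_isClosed
    (hL : ∀ c : M, Continuous (c * ·)) (hR : ∀ c : M, Continuous (· * c))
    (hd : Dense {g : M | IsUnit g}) {Z : Set M} (hZ : IsClosed Z) {y : M}
    (hy : unitOrbit y ⊆ Z) (s t : M) : s * y * t ∈ Z := by
  have h1 (a : Mˣ) (t : M) : a * y * t ∈ Z := by
    refine closure_minimal ?_ (hZ.preimage (hL (a * y))) (hd t)
    rintro _ ⟨b, rfl⟩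
    exact hy ⟨a, b, rfl⟩
  refine closure_minimal ?_ (hZ.preimage ((hR t).comp (hR y))) (hd s)
  rintro _ ⟨a, rfl⟩
  exact h1 a t

/-- If the units are dense, a closed orbit is an ideal, hence the smallest one. -/
lemma isMonoidKernel_of_isClosed_unitOrbit
    (hL : ∀ c : M, Continuous (c * ·)) (hR : ∀ c : M, Continuous (· * c))
    (hd : Dense {g : M | IsUnit g}) {y : M} (hy : IsClosed (unitOrbit y)) :
    IsMonoidKernel (unitOrbit y) := by
  have h1 : ∀ s t : M, ∀ x ∈ unitOrbit y, s * x * t ∈ unitOrbit y := fun s t x hx ↦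
    mul_mul_mem_of_isClosed hL hR hd hy (unitOrbit_eq_of_mem hx).subset s t
  refine ⟨⟨⟨y, mem_unitOrbit_self y⟩, h1⟩, fun I ⟨⟨i, hi⟩, hI⟩ ↦ ?_⟩
  have hiy : i * y ∈ unitOrbit y := by simpa using h1 i 1 y (mem_unitOrbit_self y)
  rw [← unitOrbit_eq_of_mem hiy]
  rintro _ ⟨a, b, rfl⟩
  simpa [mul_assoc] using hI a (y * b) i hi

/-- An orbit that contains a nonempty open piece of its closure is open in its closure, since it is
covered by the translates of that piece. -/
lemma isClosed_closure_diff_unitOrbit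
    (hL : ∀ c : M, Continuous (c * ·)) (hR : ∀ c : M, Continuous (· * c))
    {y : M} {O : Set M} (hO : IsOpen O) (hne : (O ∩ unitOrbit y).Nonempty)
    (hsub : O ∩ closure (unitOrbit y) ⊆ unitOrbit y) :
    IsClosed (closure (unitOrbit y) \ unitOrbit y) := by
  obtain ⟨x₀, hx₀O, hx₀⟩ := hne
  have : closure (unitOrbit y) \ unitOrbit y =
      closure (unitOrbit y) \ ⋃ c : Mˣ × Mˣ, (fun x ↦ c.1 * x * c.2) ⁻¹' O := by
    ext z
    refine and_congr_right fun hz ↦ not_congr ⟨fun hzy ↦ ?_, fun hzO ↦ ?_⟩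
    · rw [← unitOrbit_eq_of_mem hzy] at hx₀
      obtain ⟨a, b, rfl⟩ := hx₀
      exact Set.mem_iUnion.2 ⟨(a, b), hx₀O⟩
    · obtain ⟨⟨a, b⟩, hab⟩ := Set.mem_iUnion.1 hzO
      have h1 := hsub ⟨hab, mul_mul_mem_closure_unitOrbit hL hR hz a b⟩
      simpa [mul_assoc] using mul_mul_mem_unitOrbit h1 a⁻¹ b⁻¹
  rw [this]
  exact isClosed_closure.sdiff
    (isOpen_iUnion fun c ↦ hO.preimage (continuous_mul_mul hL hR c.1 c.2))

/-- If every orbit is open in its closure and the topology is Noetherian, some orbit is closed: any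
orbit in a minimal nonempty closed invariant subset. -/
lemma exists_isClosed_unitOrbit
    (hL : ∀ c : M, Continuous (c * ·)) (hR : ∀ c : M, Continuous (· * c))
    [NoetherianSpace M]
    (ho : ∀ y : M, ∃ O, IsOpen O ∧ (O ∩ unitOrbit y).Nonempty ∧
      O ∩ closure (unitOrbit y) ⊆ unitOrbit y) :
    ∃ y : M, IsClosed (unitOrbit y) := by
  let F : Set (Closeds M) := {Z | (Z : Set M).Nonempty ∧ ∀ x ∈ Z, ∀ a b : Mˣ, a * x * b ∈ Z}
  obtain ⟨Z, ⟨⟨y, hy⟩, hZ⟩, hmin⟩ := (wellFounded_lt (α := Closeds M)).has_min F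
    ⟨⊤, ⟨1, trivial⟩, fun _ _ _ _ ↦ trivial⟩
  refine ⟨y, ?_⟩
  obtain ⟨O, hO, hne, hsub⟩ := ho y
  have hyZ : closure (unitOrbit y) ⊆ Z := by
    refine closure_minimal ?_ Z.isClosed
    rintro _ ⟨a, b, rfl⟩
    exact hZ y hy a b
  let D : Closeds M := ⟨_, isClosed_closure_diff_unitOrbit hL hR hO hne hsub⟩
  by_contra hcl
  have hD : D ∈ F := by
    constructor
    · by_contra hemp
      refine hcl (closure_subset_iff_isClosed.1 fun z hz ↦ ?_)
      by_contra hzy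
      exact hemp ⟨z, hz, hzy⟩
    · refine fun x hx a b ↦ ⟨mul_mul_mem_closure_unitOrbit hL hR hx.1 a b, fun h ↦ hx.2 ?_⟩
      simpa [mul_assoc] using mul_mul_mem_unitOrbit h a⁻¹ b⁻¹
  refine hmin D hD (lt_of_le_of_ne (fun x hx ↦ hyZ hx.1) fun h ↦ ?_)
  rw [← h] at hy
  exact hy.2 (mem_unitOrbit_self y)

end TopologicalMonoids

/-! ### Orbits of the two-sided action -/

section Orbits

variable {k : Type u} [Field k] {S G : Over (Spec (.of k))} [MonObj S] [GrpObj G]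

lemma continuous_mul_left_points (c : Points S) : Continuous fun p : Points S ↦ c * p := by
  simpa only [point_comp_mulLeftHom] using Points.continuous_comp (mulLeftHom c)

lemma continuous_mul_right_points (c : Points S) : Continuous fun p : Points S ↦ p * c := by
  simpa only [point_comp_mulRightHom] using Points.continuous_comp (mulRightHom c)

lemma isClosed_setOf_mul_eq [IsAlgClosed k] [LocallyOfFiniteType S.hom] [IsSeparated S.hom]
    (c : Points S) : IsClosed {x : Points S | c * x = x} := by
  simpa only [point_comp_mulLeftHom, Category.comp_id] using
    Points.isClosed_setOf_comp_eq (mulLeftHom c) (𝟙 S)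

variable (i : G ⟶ S) [IsMonHom i]

lemma isUnit_comp_monHom {T : Over (Spec (.of k))} (a : T ⟶ G) : IsUnit (a ≫ i) :=
  (Group.isUnit a).map (IsMonHom.monoidHom i T)

/-- If the units of `S(k)` are the `k`-points of `G`, then the orbits of `G × G` on `S(k)` are the
orbits under left and right multiplication by units. -/
lemma orbit_twoSidedAction_eq_unitOrbit
    (hi : ∀ g : Points S, IsUnit g → ∃ a : Points G, a ≫ i = g) (y : Points S) :
    letI := twoSidedAction i
    MulAction.orbit (Points (G ⊗ G)) y = unitOrbit y := by
  ext x
  constructor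
  · rintro ⟨m, rfl⟩
    obtain ⟨a, b, rfl⟩ : ∃ a b : Points G, m = lift a b :=
      ⟨m ≫ fst _ _, m ≫ snd _ _, by simp [← comp_lift]⟩
    obtain ⟨u, hu⟩ := isUnit_comp_monHom i a
    obtain ⟨v, hv⟩ := isUnit_comp_monHom i b⁻¹
    exact ⟨u, v, by rw [hu, hv]; exact (twoSidedAction_smul i a b y).symm⟩
  · rintro ⟨u, v, rfl⟩
    obtain ⟨a, ha⟩ := hi u u.isUnit
    obtain ⟨b, hb⟩ := hi v v.isUnit
    refine ⟨lift a b⁻¹, (twoSidedAction_smul i a b⁻¹ y).trans ?_⟩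
    rw [ha, inv_inv, hb]

/-- By Chevalley's theorem, an orbit of `G × G` on `S(k)` contains a nonempty open piece of its
closure. -/
lemma exists_isOpen_inter_closure_unitOrbit_subset [IsAlgClosed k] [LocallyOfFiniteType S.hom]
    [QuasiCompact S.hom] [LocallyOfFiniteType G.hom] [QuasiCompact G.hom]
    (hi : ∀ g : Points S, IsUnit g → ∃ a : Points G, a ≫ i = g) (y : Points S) :
    ∃ O, IsOpen O ∧ (O ∩ unitOrbit y).Nonempty ∧ O ∩ closure (unitOrbit y) ⊆ unitOrbit y := by
  let o : G ⊗ G ⟶ S := (fst G G ≫ i) * (toUnit _ ≫ y) * (snd G G ≫ i)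
  have ho (p : Points (G ⊗ G)) : p ≫ o = (p ≫ fst _ _ ≫ i) * y * (p ≫ snd _ _ ≫ i) := by
    simp only [o, MonObj.comp_mul, ← Category.assoc p (toUnit _)]
    rw [toUnit_unique (p ≫ toUnit _) (𝟙 _), Category.id_comp]
  have hlft : LocallyOfFiniteType (G ⊗ G).hom :=
    inferInstanceAs (LocallyOfFiniteType (pullback.fst _ _ ≫ G.hom))
  have hqc : QuasiCompact (G ⊗ G).hom :=
    inferInstanceAs (QuasiCompact (pullback.fst _ _ ≫ G.hom))
  have horb (p : Points (G ⊗ G)) : p ≫ o ∈ unitOrbit y := by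
    obtain ⟨u, hu⟩ := isUnit_comp_monHom i (p ≫ fst _ _)
    obtain ⟨v, hv⟩ := isUnit_comp_monHom i (p ≫ snd _ _)
    exact ⟨u, v, by rw [hu, hv, ho, Category.assoc, Category.assoc]⟩
  have hE (p : Points S) : p ∈ unitOrbit y ↔ p.pt ∈ Set.range o.left := by
    constructor
    · rintro ⟨u, v, rfl⟩
      obtain ⟨a, ha⟩ := hi u u.isUnit
      obtain ⟨b, hb⟩ := hi v v.isUnit
      refine ⟨Points.pt (lift a b : Points (G ⊗ G)), ?_⟩
      rw [← Points.pt_comp, ho, lift_fst_assoc, lift_snd_assoc, ha, hb]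
    · intro hp
      obtain ⟨q, rfl⟩ := Points.exists_comp_eq o p hp
      exact horb q
  have hcons : Topology.IsConstructible (Set.range o.left) := by
    have : IsLocallyNoetherian S.left :=
      LocallyOfFiniteType.isLocallyNoetherian (Y := Spec (.of k)) S.hom
    have : CompactSpace S.left := QuasiCompact.compactSpace_of_compactSpace S.hom
    have : LocallyOfFiniteType o.left := by
      have : LocallyOfFiniteType (o.left ≫ S.hom) := by rwa [Over.w]
      exact locallyOfFiniteType_of_comp o.left S.hom
    have : CompactSpace (G ⊗ G).left :=
      QuasiCompact.compactSpace_of_compactSpace (Y := Spec (.of k)) (G ⊗ G).hom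
    rw [← Set.image_univ]
    exact o.left.isConstructible_image .univ
  obtain ⟨O, -, hO, hne, hsub⟩ := exists_isOpen_inter_closure_subset hcons isOpen_univ
    (by
      rw [Set.univ_inter]
      exact ⟨_, Points.pt (1 : Points (G ⊗ G)), rfl⟩)
  refine ⟨Points.pt ⁻¹' O, hO.preimage (Points.continuous_pt S), ?_, ?_⟩
  · obtain ⟨_, hzO, z, rfl⟩ := hne
    obtain ⟨p, hp⟩ := Points.exists_pt_mem (X := G ⊗ G)
      (hO.preimage o.left.continuous).isLocallyClosed ⟨z, hzO⟩
    refine ⟨p ≫ o, ?_, horb p⟩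
    rw [Set.mem_preimage, Points.pt_comp]
    exact hp
  · rintro p ⟨hpO, hp⟩
    exact (hE p).2 (hsub ⟨hpO,
      map_mem_closure (Points.continuous_pt S) hp fun q hq ↦ (hE q).1 hq⟩)

/-- `i` is equivariant for the two-sided actions of `G × G`. -/
lemma twoSidedMap_id_comp :
    twoSidedMap (𝟙 G) ≫ i = (G ⊗ G) ◁ i ≫ twoSidedMap i := by
  rw [comp_twoSidedMap, twoSidedMap, MonObj.mul_comp, MonObj.mul_comp]
  simp

/-- `S` contains the group of units as the orbit of `1`. -/
lemma isGroupEmbedding_twoSidedAction {U : S.left.Opens} [GrpObj (openSub S U)]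
    [IsMonHom (openSubι S U)] (hU : openPoints S U = unitSet (Points S))
    (hi : ∀ g : Points S, IsUnit g → ∃ a : Points (openSub S U), a ≫ openSubι S U = g) :
    letI := twoSidedAction (openSubι S U)
    IsGroupEmbedding (openSub S U) S := by
  refine ⟨1, U, Iso.refl _, ?_, ?_⟩
  · rw [orbit_twoSidedAction_eq_unitOrbit _ hi, hU]
    ext g
    rw [mem_unitSet_iff]
    constructor
    · rintro ⟨a, b, rfl⟩
      exact ⟨a * b, by simp⟩
    · rintro ⟨u, rfl⟩
      exact ⟨u, 1, by simp⟩
  · let _ := twoSidedAction (𝟙 (openSub S U))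
    let _ := twoSidedAction (openSubι S U)
    refine ⟨?_⟩
    change twoSidedMap (𝟙 _) ≫ (𝟙 _ ≫ openSubι S U) =
      (openSub S U ⊗ openSub S U) ◁ (𝟙 _ ≫ openSubι S U) ≫ twoSidedMap (openSubι S U)
    rw [Category.id_comp, twoSidedMap_id_comp]

variable [IsAlgClosed k] [LocallyOfFiniteType S.hom] [IsReduced S.left] [IrreducibleSpace S.left]
  [IsSeparated S.hom] [QuasiCompact S.hom]

lemma dense_isUnit_points : Dense {g : Points S | IsUnit g} := by
  refine fun p ↦ mem_closure_iff.2 ?_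
  rintro _ ⟨O, hO, rfl⟩ hp
  obtain ⟨q, hqO, hq⟩ := Points.exists_pt_mem (X := S)
    (hO.inter (unitOpens S).isOpen).isLocallyClosed
    (nonempty_preirreducible_inter hO (unitOpens S).isOpen ⟨_, hp⟩ nonempty_unitOpens)
  exact ⟨q, hqO, pt_mem_unitOpens_iff.1 hq⟩

end Orbits

end AlgMonoid

open AlgMonoid

theorem mainTheorem1 {k : Type u} [Field k] [IsAlgClosed k] (S : Over (Spec (.of k)))
    [AlgMonoid.IsVariety S] [IrreducibleSpace S.left] [MonObj S] :
    (∃ (U : S.left.Opens) (_ : GrpObj (AlgMonoid.openSub S U))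
        (_ : IsMonHom (AlgMonoid.openSubι S U)),
      letI := AlgMonoid.twoSidedAction (AlgMonoid.openSubι S U)
      AlgMonoid.openPoints S U = AlgMonoid.unitSet (AlgMonoid.Points S) ∧
      AlgMonoid.IsVariety (AlgMonoid.openSub S U) ∧
      ConnectedSpace (AlgMonoid.openSub S U).left ∧
      AlgMonoid.IsSimpleGroupEmbedding (AlgMonoid.openSub S U) S ∧
      ∀ Y : Set (AlgMonoid.Points S),
        AlgMonoid.IsClosedOrbit (AlgMonoid.openSub S U ⊗ AlgMonoid.openSub S U) S Y →
        AlgMonoid.IsMonoidKernel Y) ∧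
    ∀ s t : AlgMonoid.Points S, s * t = 1 →
      s ∈ AlgMonoid.unitSet (AlgMonoid.Points S) ∧
      t ∈ AlgMonoid.unitSet (AlgMonoid.Points S) := by
  obtain ⟨hred, hsep, hlft, hqc⟩ := ‹IsVariety S›
  have hloc : IsLocallyNoetherian S.left :=
    LocallyOfFiniteType.isLocallyNoetherian (Y := Spec (.of k)) S.hom
  have hcpt : CompactSpace S.left := QuasiCompact.compactSpace_of_compactSpace S.hom
  have hnoeth : IsNoetherian S.left := { }
  have hsymm {s t : Points S} (h : s * t = 1) : t * s = 1 :=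
    mul_eq_one_symm_of_noetherianSpace isClosed_setOf_mul_eq h
  refine ⟨?_, fun s t h ↦ ⟨⟨t, h, hsymm h⟩, ⟨s, hsymm h, h⟩⟩⟩
  obtain ⟨hG, hι⟩ := exists_grpObj_unitOpens S
  let U := unitOpens S
  have hUred : IsReduced (openSub S U).left :=
    inferInstanceAs (IsReduced U.toScheme)
  have hUsep : IsSeparated (openSub S U).hom :=
    inferInstanceAs (IsSeparated (U.ι ≫ S.hom))
  have hUlft : LocallyOfFiniteType (openSub S U).hom :=
    inferInstanceAs (LocallyOfFiniteType (U.ι ≫ S.hom))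
  have hUqc : QuasiCompact (openSub S U).hom :=
    inferInstanceAs (QuasiCompact (U.ι ≫ S.hom))
  have hU : openPoints S U = unitSet (Points S) := by
    ext g
    exact pt_mem_unitOpens_iff.trans mem_unitSet_iff.symm
  have hUne : Nonempty U.toScheme := nonempty_unitOpens.to_subtype
  have hi (g : Points S) (hg : IsUnit g) :
      ∃ a : Points (openSub S U), a ≫ openSubι S U = g := by
    have : LocallyOfFiniteType (𝟙_ (Over (Spec (.of k)))).hom :=
      inferInstanceAs (LocallyOfFiniteType (𝟙 _))
    exact exists_comp_openSubι_eq_of_isUnit hg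
  have horb (y : Points S) :
      let _ := twoSidedAction (openSubι S U)
      MulAction.orbit (Points (openSub S U ⊗ openSub S U)) y =
        unitOrbit y :=
    orbit_twoSidedAction_eq_unitOrbit _ hi y
  let _ := twoSidedAction (openSubι S U)
  have hker (Y : Set (Points S))
      (hY : IsClosedOrbit (openSub S U ⊗ openSub S U) S Y) :
      IsMonoidKernel Y := by
    obtain ⟨⟨y, rfl⟩, hcl⟩ := hY
    rw [horb] at hcl ⊢
    exact isMonoidKernel_of_isClosed_unitOrbit continuous_mul_left_points
      continuous_mul_right_points dense_isUnit_points hcl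
  obtain ⟨y, hy⟩ := exists_isClosed_unitOrbit
    (continuous_mul_left_points (S := S)) continuous_mul_right_points
    (exists_isOpen_inter_closure_unitOrbit_subset (openSubι S U) hi)
  have hy' : IsClosedOrbit (openSub S U ⊗ openSub S U) S
      (unitOrbit y) := ⟨⟨y, (horb y).symm⟩, hy⟩
  refine ⟨U, hG, hι, hU, ⟨hUred, hUsep, hUlft, hUqc⟩, ?_,
    ⟨isGroupEmbedding_twoSidedAction hU hi, _, hy', fun Y hY ↦ ?_⟩, hker⟩
  · have : IsIntegral S.left := isIntegral_of_irreducibleSpace_of_isReduced S.left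
    exact inferInstanceAs (ConnectedSpace U.toScheme)
  · exact ((hker Y hY).2 _ (hker _ hy').1).antisymm ((hker _ hy').2 _ (hker Y hY).1)
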